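/- Let $(R,\varsigma)$ be a transformal domain (an integral domain with an injective endomorphism) and $S=\operatorname{Spec}R$. A variety is a reduced separated scheme of finite presentation over $S$. An almost direct presentation $(X,\Sigma)$ over $(R,\varsigma)$ consists of varieties $X_0,X_1$, an $S$-morphism $\pi:X_1\to X_0$, and a family of morphisms $\sigma:X_1\to X_0$, indexed by $\sigma\in\Sigma$, lying over $\operatorname{Spec}\varsigma:S\to S$. A morphism $f:(X,\Sigma)\to(Y,T)$ consists of a map $\sigma\mapsto\sigma^f$, $\Sigma\to T$, and $S$-morphisms $f_i:X_i\to Y_i$ with $f_0\pi=\pi f_1$ and $f_0\sigma=\sigma^f f_1$; it is directly finite étale if $f_0,f_1$ are finite étale. We write $(X,\sigma)$ if $\Sigma=\{\sigma\}$. A Galois cover is a finite étale cover with connected source whose automorphism group acts transitively on geometric fibres. An almost direct Galois cover is a morphism $(Z,\Sigma)\to(X,T)$ such that $Z_i/X_i$ is a Galois cover with group $G_i$ ($i=0,1$); $G_0$ acts on $\Sigma$ by composition, with $T\simeq G_0\backslash\Sigma$; and there are homomorphisms $g\mapsto g^{\pi}$ and $g\mapsto g^{\sigma}$ ($\sigma\in\Sigma$)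 from $G_1$ to $G_0$ with $\pi g=g^{\pi}\pi$ and $\sigma g=g^\sigma\sigma$ for $g\in G_1$. The group $G_1$ acts on $\Sigma$ by conjugation, $\sigma\mapsto g^{\pi}\sigma g^{-1}=g^\pi(g^{-1})^\sigma\sigma$; a conjugacy domain is a subset $C\subseteq\Sigma$ stable under this action. Let $s$ be a prime of $R$ with $\varsigma^{-1}(s)=s$, and let $(F,\varphi)$ be an algebraically closed difference field extending the difference field $\kappa(s)$. A point of $(X,\Sigma)_s$ in $(F,\varphi)$ is a point $x_1\in X_1(F)$ above $\operatorname{Spec}F\to\operatorname{Spec}\kappa(s)\to S$ such that $\sigma x_1=(\pi x_1)\varphi$ for some $\sigma\in\Sigma$; put $x_0=\pi x_1$. For an almost direct Galois cover $(Z,\Sigma)\to(X,\sigma)$ and a point $x$ of $(X,\sigma)$, the local substitution $\varphi_x\subseteq\Sigma$ is the conjugacy class of any $\tau\in\Sigma$ with $\tau z_1=z_0\varphi$ for a point $z$ of $(Z,\Sigma)$ above $x$. For a conjugacy domain $C$, the Galois formula $\langle Z/X,C\rangle^\sharp$ assigns to $(s,(F,\varphi))$ the set of all $x_0$, where $x$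 runs through the points of $(X,\sigma)_s$ in $(F,\varphi)$ with $\varphi_x\subseteq C$. Let $f:(X,\sigma)\to(Y,\sigma)$ be directly finite étale with $Y_0,Y_1$ connected, let $p:(Z,\Sigma)\to(X,\sigma)$ be an almost direct Galois cover, and fix $\sigma_Z\in\Sigma$. A direct Galois closure of $Z$ over $Y$ is formed as follows. Let $\tilde Z_0\to Z_0$ be a Galois closure of $Z_0$ over $Y_0$. Let $\mathring Z_1$ be a connected component of $\tilde Z_0\times_{Z_0,\pi}Z_1\times_{\sigma_Z,Z_0}\tilde Z_0$, and let $\tilde Z_1$ be the connected component of $\tilde Z_0\times_{Y_0,\pi}Y_1\times_{\sigma,Y_0}\tilde Z_0$ into which it is mapped. Put $\mathring Z_0=\tilde Z_0$, let $\pi$ be the projection to the left factor $\tilde Z_0$, and let $\tilde\Sigma$ (resp. $\mathring\Sigma$) be the set of all $g\circ\mathrm{pr}$, with $\mathrm{pr}$ the projection to the right factor and $g\in\operatorname{Gal}(\tilde Z_0/Y_0)$ (resp. $g\in\operatorname{Gal}(\tilde Z_0/X_0)$). This gives morphisms $(\mathring Z,\mathring\Sigma)\to(Z,\Sigma)$,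 where $\mathring\Sigma\to\Sigma$ maps $g\circ\mathrm{pr}$ to $\bar g\sigma_Z$ with $\bar g\in\operatorname{Gal}(Z_0/X_0)$ induced by $g$, and $(\mathring Z,\mathring\Sigma)\to(\tilde Z,\tilde\Sigma)$, given on indices by the inclusion $\iota:\mathring\Sigma\hookrightarrow\tilde\Sigma$, $g\circ\mathrm{pr}\mapsto g\circ\mathrm{pr}$. Then $(\tilde Z,\tilde\Sigma)\to(Y,\sigma)$ is an almost direct Galois cover and, for every conjugacy domain $C\subseteq\Sigma$ with preimage $\mathring C\subseteq\mathring\Sigma$, $$f_\exists^\sharp\langle Z/X,C\rangle=\langle\tilde Z/Y,\iota_*\mathring C\rangle^\sharp,$$ where $\iota_*\mathring C$ is the least conjugacy domain in $\tilde\Sigma$ containing $\iota(\mathring C)$. That is, for all $s$ and all algebraically closed difference fields $(F,\varphi)$ extending $\kappa(s)$, the image under $f_0$ of $\langle Z/X,C\rangle^\sharp(s,(F,\varphi))$ is $\langle\tilde Z/Y,\iota_*\mathring C\rangle^\sharp(s,(F,\varphi))$. -/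

import Mathlib

open CategoryTheory CategoryTheory.Limits AlgebraicGeometry

universe u

namespace DirectPresentation

noncomputable section

/-! ### Finite étale morphisms: helper facts -/

theorem isReduced_of_finite_etale_ring (A B : Type u) [CommRing A] [CommRing B] [Algebra A B]
    [_root_.IsReduced A] [Module.Finite A B] [Algebra.Etale A B] : _root_.IsReduced B := by
  have hfp : Module.FinitePresentation A B :=
    Module.FinitePresentation.of_finite_of_finitePresentation A B
  have hflat : Module.Flat A B := inferInstance
  have : Module.Projective A B := Module.Flat.projective_of_finitePresentation
  refine ⟨fun b hb => ?_⟩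
  by_contra hne
  obtain ⟨l, hl⟩ : ∃ l : Module.Dual A B, l b ≠ 0 := by
    by_contra! h
    exact hne ((Module.forall_dual_apply_eq_zero_iff A b).mp h)
  obtain ⟨P, hP, hlP⟩ : ∃ P : Ideal A, P.IsPrime ∧ l b ∉ P := by
    by_contra! h
    apply hl
    have : l b ∈ nilradical A := by
      rw [nilradical_eq_sInf]
      exact Ideal.mem_sInf.mpr fun {I} hI => h I hI
    rwa [nilradical_eq_zero] at this
  have hr : _root_.IsReduced (TensorProduct A P.ResidueField B) :=
    Algebra.FormallyUnramified.isReduced_of_field P.ResidueField _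
  have h0 : TensorProduct.tmul A (1 : P.ResidueField) b = 0 := by
    have : IsNilpotent (TensorProduct.tmul A (1 : P.ResidueField) b) :=
      hb.map (Algebra.TensorProduct.includeRight : B →ₐ[A] TensorProduct A P.ResidueField B)
    exact this.eq_zero
  have h1 := congrArg (LinearMap.lTensor P.ResidueField l) h0
  rw [LinearMap.lTensor_tmul, map_zero] at h1
  have h2 := congrArg (TensorProduct.rid A P.ResidueField) h1
  rw [TensorProduct.rid_tmul, map_zero, Algebra.smul_def, mul_one] at h2
  exact hlP (Ideal.algebraMap_residueField_eq_zero.mp h2)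

theorem isReduced_of_finite_etale {X Y : Scheme.{u}} (f : X ⟶ Y) [IsFinite f] [Etale f]
    [IsReduced Y] : IsReduced X := by
  apply +allowSynthFailures @IsReduced.of_openCover (𝒰 := Y.affineCover.pullback₁ f)
  intro i
  let i : Y.affineCover.I₀ := i
  change IsReduced (pullback f (Y.affineCover.f i))
  have : IsReduced (Y.affineCover.X i) := isReduced_of_isOpenImmersion (Y.affineCover.f i)
  let g : pullback f (Y.affineCover.f i) ⟶ Y.affineCover.X i := pullback.snd _ _
  have : IsAffine (pullback f (Y.affineCover.f i)) := isAffine_of_isAffineHom g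
  have h1 : g.appTop.hom.Finite := g.finite_appTop
  have h2 : g.appTop.hom.Etale :=
    (HasRingHomProperty.iff_of_isAffine (P := @Etale)).mp inferInstance
  algebraize [g.appTop.hom]
  have := isReduced_of_finite_etale_ring Γ(Y.affineCover.X i, ⊤)
    Γ(pullback f (Y.affineCover.f i), ⊤)
  exact isReduced_of_isAffine_isReduced (X := pullback f (Y.affineCover.f i))

/-- Two morphisms from a connected scheme to a separated étale scheme agree as soon as they agree
at one field-valued point. -/
theorem hom_ext_of_point {T Z X : Scheme.{u}} (p : Z ⟶ X) [Etale p] [IsSeparated p]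
    [PreconnectedSpace T] (a b : T ⟶ Z) (h : a ≫ p = b ≫ p) {K : Type u} [Field K]
    (t : Spec (.of K) ⟶ T) (ht : t ≫ a = t ≫ b) : a = b := by
  obtain ⟨c, hc1, hc2⟩ : ∃ c : T ⟶ pullback p p,
      c ≫ pullback.fst p p = a ∧ c ≫ pullback.snd p p = b :=
    ⟨pullback.lift a b h, pullback.lift_fst _ _ _, pullback.lift_snd _ _ _⟩
  let e : pullback c (pullback.diagonal p) ⟶ T := pullback.fst _ _
  have : IsOpenImmersion e := inferInstance
  have : IsClosedImmersion e := inferInstance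
  have hcl : IsClopen (Set.range e) :=
    ⟨e.isClosedEmbedding.isClosed_range, e.isOpenEmbedding.isOpen_range⟩
  have hne : (Set.range e).Nonempty := by
    let t' : Spec (.of K) ⟶ pullback c (pullback.diagonal p) :=
      pullback.lift t (t ≫ a) (by
        apply pullback.hom_ext <;> simp [hc1, hc2, ht])
    exact ⟨_, ⟨t' (default : PrimeSpectrum K), rfl⟩⟩
  have hs : Set.range e = Set.univ := hcl.eq_univ hne
  have : Surjective e := ⟨Set.range_eq_univ.mp hs⟩
  have : IsIso e := IsOpenImmersion.isIso e
  have hc : e ≫ c = pullback.snd _ _ ≫ pullback.diagonal p := pullback.condition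
  have ha := congrArg (· ≫ pullback.fst p p) hc
  have hb := congrArg (· ≫ pullback.snd p p) hc
  simp only [Category.assoc, hc1, hc2, pullback.diagonal_fst, pullback.diagonal_snd] at ha hb
  exact (cancel_epi e).mp (ha.trans hb.symm)

/-! ### Varieties and almost direct presentations -/

/-- `s : X ⟶ S` is an algebraic variety over the affine scheme `S`: `X` is reduced, and separated
and of finite presentation over `S`. -/
structure IsVariety {X S : Scheme.{u}} (s : X ⟶ S) : Prop where
  isReduced : IsReduced X
  isSeparated : IsSeparated s
  locallyOfFinitePresentation : LocallyOfFinitePresentation s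
  quasiCompact : QuasiCompact s

theorem IsVariety.of_finite_etale {X Y S : Scheme.{u}} {s : Y ⟶ S} (hs : IsVariety s) (f : X ⟶ Y)
    [IsFinite f] [Etale f] : IsVariety (f ≫ s) := by
  obtain ⟨h1, h2, h3, h4⟩ := hs
  exact ⟨isReduced_of_finite_etale f, inferInstance, inferInstance, inferInstance⟩

end

end DirectPresentation

open DirectPresentation

/-- An object `(X, Σ)` of the category of almost direct presentations over the difference ring
`(R, ς)`: `X₀` and `X₁` are varieties over `S = Spec R`, `π : X₁ ⟶ X₀` is an `S`-morphism, and
every index `σ : Idx` (an element of `Σ`) gives a morphism `map σ : X₁ ⟶ X₀` which lies over the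
endomorphism `Spec ς` of `S`. -/
structure AlmostDirect {R : Type u} [CommRing R] (ς : R →+* R) where
  X₀ : Scheme.{u}
  X₁ : Scheme.{u}
  s₀ : X₀ ⟶ Spec (.of R)
  s₁ : X₁ ⟶ Spec (.of R)
  isVariety₀ : IsVariety s₀
  isVariety₁ : IsVariety s₁
  π : X₁ ⟶ X₀
  π_comp : π ≫ s₀ = s₁
  Idx : Type u
  map : Idx → (X₁ ⟶ X₀)
  map_comp : ∀ σ, map σ ≫ s₀ = s₁ ≫ Spec.map (CommRingCat.ofHom ς)

namespace AlmostDirect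

noncomputable section

variable {R : Type u} [CommRing R] {ς : R →+* R}

/-- Morphisms `(X, Σ) ⟶ (Y, T)` of almost direct presentations. -/
@[ext]
structure Hom (X Y : AlmostDirect ς) where
  idx : X.Idx → Y.Idx
  f₀ : X.X₀ ⟶ Y.X₀
  f₁ : X.X₁ ⟶ Y.X₁
  f₀_comp : f₀ ≫ Y.s₀ = X.s₀
  f₁_comp : f₁ ≫ Y.s₁ = X.s₁
  comm_π : X.π ≫ f₀ = f₁ ≫ Y.π
  comm_map : ∀ σ, X.map σ ≫ f₀ = f₁ ≫ Y.map (idx σ)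

instance : Category (AlmostDirect ς) where
  Hom := Hom
  id X := ⟨id, 𝟙 _, 𝟙 _, by simp, by simp, by simp, by simp⟩
  comp {X Y Z} f g :=
    { idx := g.idx ∘ f.idx
      f₀ := f.f₀ ≫ g.f₀
      f₁ := f.f₁ ≫ g.f₁
      f₀_comp := by rw [Category.assoc, g.f₀_comp, f.f₀_comp]
      f₁_comp := by rw [Category.assoc, g.f₁_comp, f.f₁_comp]
      comm_π := by rw [← Category.assoc, f.comm_π, Category.assoc, g.comm_π, Category.assoc]
      comm_map := fun σ => by
        rw [← Category.assoc, f.comm_map, Category.assoc, g.comm_map, Category.assoc]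
        rfl }
  id_comp _ := by apply Hom.ext <;> rfl
  comp_id _ := by apply Hom.ext <;> rfl
  assoc _ _ _ := by apply Hom.ext <;> rfl

variable {X Y Z : AlmostDirect ς}

@[simp] theorem comp_idx (f : X ⟶ Y) (g : Y ⟶ Z) (σ : X.Idx) :
    (f ≫ g).idx σ = g.idx (f.idx σ) := rfl

@[simp] theorem comp_f₀ (f : X ⟶ Y) (g : Y ⟶ Z) : (f ≫ g).f₀ = f.f₀ ≫ g.f₀ := rfl

@[simp] theorem comp_f₁ (f : X ⟶ Y) (g : Y ⟶ Z) : (f ≫ g).f₁ = f.f₁ ≫ g.f₁ := rfl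

/-- `f` is directly finite étale: `f₀` and `f₁` are finite étale (and so is then the base change
of `f₀` along `Spec ς`). -/
structure DirectlyFiniteEtale (f : X ⟶ Y) : Prop where
  isFinite₀ : IsFinite f.f₀
  etale₀ : Etale f.f₀
  isFinite₁ : IsFinite f.f₁
  etale₁ : Etale f.f₁

end

end AlmostDirect

namespace DirectPresentation

noncomputable section

variable {R : Type u} [CommRing R] {ς : R →+* R}

/-! ### Galois covers, Galois closures, connected components -/

/-- The group of automorphisms of `X` over `Y`. For `g h : Gal f` the product `g * h` acts as
"first `h`, then `g`". -/
abbrev Gal {X Y : Scheme.{u}} (f : X ⟶ Y) : Type u := Aut (Over.mk f)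

/-- The automorphism of the scheme `X` underlying `g`. -/
abbrev Gal.toHom {X Y : Scheme.{u}} {f : X ⟶ Y} (g : Gal f) : X ⟶ X := g.hom.left

theorem Gal.toHom_comp {X Y : Scheme.{u}} {f : X ⟶ Y} (g : Gal f) : g.toHom ≫ f = f :=
  Over.w g.hom

/-- `f : X ⟶ Y` is a (finite étale, connected) Galois cover, with group `Gal f`: the automorphism
group acts transitively on the geometric fibres. -/
structure IsGaloisCover {X Y : Scheme.{u}} (f : X ⟶ Y) : Prop where
  isFinite : IsFinite f
  etale : Etale f
  surjective : Surjective f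
  connected : ConnectedSpace X
  transitive : ∀ (K : Type u) [Field K] [IsAlgClosed K] (x x' : Spec (.of K) ⟶ X),
    x ≫ f = x' ≫ f → ∃ g : Gal f, x ≫ g.toHom = x'

/-- `q : T ⟶ X` is a Galois closure of `h : X ⟶ Y`: the composite `T ⟶ Y` is a Galois cover,
and every Galois cover of `Y` which dominates `X` dominates `T` over `X`. -/
structure IsGaloisClosure {T X Y : Scheme.{u}} (q : T ⟶ X) (h : X ⟶ Y) : Prop where
  isGaloisCover : IsGaloisCover (q ≫ h)
  minimal : ∀ {T' : Scheme.{u}} (q' : T' ⟶ X), IsGaloisCover (q' ≫ h) →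
    ∃ r : T' ⟶ T, r ≫ q = q'

/-- `j` is the inclusion of a connected component. -/
structure IsComponent {T W : Scheme.{u}} (j : T ⟶ W) : Prop where
  isOpenImmersion : IsOpenImmersion j
  range_eq : ∃ w : W, Set.range j = connectedComponent w

theorem IsComponent.isClosedImmersion {T W : Scheme.{u}} {j : T ⟶ W} (hj : IsComponent j) :
    IsClosedImmersion j := by
  have := hj.isOpenImmersion
  obtain ⟨w, hw⟩ := hj.range_eq
  refine IsClosedImmersion.of_isPreimmersion j ?_
  rw [hw]
  exact isClosed_connectedComponent

/-! ### Almost direct Galois covers -/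

/-- An almost direct Galois cover `p : (Z, Σ) ⟶ (X, T)` with group `G = (G₀, G₁)`, `Gᵢ` being the
Galois group of `Zᵢ` over `Xᵢ`. -/
structure AlmostDirectGaloisCover {Z X : AlmostDirect ς} (p : Z ⟶ X) where
  galois₀ : IsGaloisCover p.f₀
  galois₁ : IsGaloisCover p.f₁
  /-- The left action of `G₀` on `Σ`. -/
  act : Gal p.f₀ →* Equiv.Perm Z.Idx
  map_act : ∀ g σ, Z.map (act g σ) = Z.map σ ≫ g.toHom
  /-- `Σ → T` identifies `T` with the set of `G₀`-orbits. -/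
  idx_surjective : Function.Surjective p.idx
  idx_eq_iff : ∀ σ τ, p.idx σ = p.idx τ ↔ ∃ g, act g σ = τ
  /-- The homomorphism `g₁ ↦ g₁ ^ π`. -/
  piHom : Gal p.f₁ →* Gal p.f₀
  piHom_comm : ∀ g, g.toHom ≫ Z.π = Z.π ≫ (piHom g).toHom
  /-- The homomorphism `g₁ ↦ g₁ ^ σ`. -/
  mapHom : Z.Idx → (Gal p.f₁ →* Gal p.f₀)
  mapHom_comm : ∀ σ g, g.toHom ≫ Z.map σ = Z.map σ ≫ (mapHom σ g).toHom

namespace AlmostDirectGaloisCover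

variable {Z X : AlmostDirect ς} {p : Z ⟶ X} (hp : AlmostDirectGaloisCover p)

/-- Conjugation: `σ ^ g = g₀ σ g₁⁻¹ = g₀ (g₁⁻¹) ^ σ σ`, where `g = g₁` and `g₀ = g₁ ^ π`. -/
def conj (g : Gal p.f₁) (σ : Z.Idx) : Z.Idx :=
  hp.act (hp.piHom g * hp.mapHom σ g⁻¹) σ

/-- `C ⊆ Σ` is a conjugacy domain, i.e. a union of conjugacy classes. -/
def IsConjDomain (C : Set Z.Idx) : Prop :=
  ∀ σ ∈ C, ∀ g, hp.conj g σ ∈ C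

/-- The least conjugacy domain containing `B`. -/
def leastConjDomain (B : Set Z.Idx) : Set Z.Idx :=
  {σ | ∀ C, hp.IsConjDomain C → B ⊆ C → σ ∈ C}

end AlmostDirectGaloisCover

/-! ### Points over difference fields, Galois formulae -/

variable (ς) in
/-- A point `s` of `Spec^ς R`, i.e. a prime ideal with `ς⁻¹(s) = s`, together with an algebraically
closed difference field `(F, φ)` extending the difference field `(κ(s), ς^s)`. -/
structure Param where
  s : PrimeSpectrum R
  comap_s : s.asIdeal = s.asIdeal.comap ς
  F : Type u
  [field : Field F]
  [isAlgClosed : IsAlgClosed F]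
  φ : F →+* F
  j : s.asIdeal.ResidueField →+* F
  φ_comp_j : φ.comp j = j.comp (Ideal.ResidueField.map s.asIdeal s.asIdeal ς comap_s)

attribute [instance] Param.field Param.isAlgClosed

namespace Param

variable (P : Param ς)

/-- The scheme `Spec F`. -/
abbrev spec : Scheme.{u} := Spec (.of P.F)

/-- The structure morphism `Spec F ⟶ Spec κ(s) ⟶ Spec R`. -/
def toBase : P.spec ⟶ Spec (.of R) :=
  Spec.map (CommRingCat.ofHom (P.j.comp (algebraMap R P.s.asIdeal.ResidueField)))

/-- The endomorphism of `Spec F` given by `φ`. -/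
def phi : P.spec ⟶ P.spec := Spec.map (CommRingCat.ofHom P.φ)

end Param

/-- `σ x₁ = (π x₁) φ` for the `F`-valued point `x₁` of `X₁`. -/
def IsSubst (X : AlmostDirect ς) (P : Param ς) (x : P.spec ⟶ X.X₁) (σ : X.Idx) : Prop :=
  x ≫ X.map σ = P.phi ≫ x ≫ X.π

/-- The `(F, φ)`-points of the fibre `(X, Σ)_s`: the `F`-valued points `x₁` of `X₁` over
`Spec F ⟶ Spec R` with `σ x₁ = (π x₁) φ` for some `σ` in `Σ`. -/
def points (X : AlmostDirect ς) (P : Param ς) : Set (P.spec ⟶ X.X₁) :=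
  {x | x ≫ X.s₁ = P.toBase ∧ ∃ σ, IsSubst X P x σ}

/-- A family of sets of `F`-valued points of `X₀`. -/
abbrev Subassignment (X : AlmostDirect ς) := ∀ P : Param ς, Set (P.spec ⟶ X.X₀)

/-- Equivalence: equality over all algebraically closed difference fields. -/
def Equivalent {X : AlmostDirect ς} (A B : Subassignment X) : Prop := ∀ P, A P = B P

/-- The direct image `f_∃^♯ A`, i.e. the image of `A` under `f₀`. -/
def existsImage {X Y : AlmostDirect ς} (f : X ⟶ Y) (A : Subassignment X) : Subassignment Y :=
  fun P => (fun x => x ≫ f.f₀) '' A P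

namespace AlmostDirectGaloisCover

variable {Z X : AlmostDirect ς} {p : Z ⟶ X} (hp : AlmostDirectGaloisCover p)

/-- The local `φ`-substitution at the point `x` of `X`: the conjugacy class of the substitution
at a point `z` of `Z` lying above `x`. -/
def localSubst (P : Param ς) (x : P.spec ⟶ X.X₁) : Set Z.Idx :=
  {τ | ∃ z ∈ points Z P, z ≫ p.f₁ = x ∧ ∃ σ, IsSubst Z P z σ ∧ ∃ g, τ = hp.conj g σ}

/-- The point set `⟨Z/X, C⟩^♭`. -/
def formulaPoints (C : Set Z.Idx) (P : Param ς) : Set (P.spec ⟶ X.X₁) :=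
  {x | x ∈ points X P ∧ hp.localSubst P x ⊆ C}

/-- The Galois formula `⟨Z/X, C⟩^♯`, the projection of `⟨Z/X, C⟩^♭` along `π`. -/
def formula (C : Set Z.Idx) : Subassignment X :=
  fun P => (fun x => x ≫ X.π) '' hp.formulaPoints C P

end AlmostDirectGaloisCover

/-! ### The direct Galois closure -/

/-- The scheme `T ×_A B ×_A T`, formed with `q : T ⟶ A` on both sides, and with `a : B ⟶ A` on the
left and `b : B ⟶ A` on the right. -/
abbrev Corr {T A B : Scheme.{u}} (q : T ⟶ A) (a b : B ⟶ A) : Scheme.{u} :=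
  pullback (pullback.snd q a) (pullback.snd q b)

namespace Corr

variable {T A B : Scheme.{u}} (q : T ⟶ A) (a b : B ⟶ A)

def left : Corr q a b ⟶ T := pullback.fst _ _ ≫ pullback.fst q a

def mid : Corr q a b ⟶ B := pullback.fst _ _ ≫ pullback.snd q a

def right : Corr q a b ⟶ T := pullback.snd _ _ ≫ pullback.fst q b

theorem left_comp : left q a b ≫ q = mid q a b ≫ a := by
  rw [left, mid, Category.assoc, Category.assoc, pullback.condition]

theorem right_comp : right q a b ≫ q = mid q a b ≫ b := by
  have h : mid q a b = pullback.snd _ _ ≫ pullback.snd q b := pullback.condition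
  rw [h, right, Category.assoc, Category.assoc, pullback.condition]

instance [IsFinite q] : IsFinite (mid q a b) :=
  inferInstanceAs (IsFinite (pullback.fst (pullback.snd q a) (pullback.snd q b) ≫ pullback.snd q a))

instance [Etale q] : Etale (mid q a b) :=
  inferInstanceAs (Etale (pullback.fst (pullback.snd q a) (pullback.snd q b) ≫ pullback.snd q a))

variable {q a b} {V : Scheme.{u}} (l : V ⟶ T) (m : V ⟶ B) (r : V ⟶ T) (hl : l ≫ q = m ≫ a)
    (hr : r ≫ q = m ≫ b)

def lift : V ⟶ Corr q a b :=
  pullback.lift (pullback.lift l m hl) (pullback.lift r m hr)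
    ((pullback.lift_snd _ _ _).trans (pullback.lift_snd _ _ _).symm)

theorem lift_left : lift l m r hl hr ≫ left q a b = l := by
  rw [lift, left, pullback.lift_fst_assoc, pullback.lift_fst]

theorem lift_mid : lift l m r hl hr ≫ mid q a b = m := by
  rw [lift, mid, pullback.lift_fst_assoc, pullback.lift_snd]

theorem lift_right : lift l m r hl hr ≫ right q a b = r := by
  rw [lift, right, pullback.lift_snd_assoc, pullback.lift_fst]

end Corr

/-- The canonical morphism `T ×_{Z₀} Z₁ ×_{Z₀} T ⟶ T ×_{Y₀} Y₁ ×_{Y₀} T`. -/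
def corrMap {Z Y : AlmostDirect ς} (h : Z ⟶ Y) (σ : Z.Idx) {T : Scheme.{u}} (q : T ⟶ Z.X₀) :
    Corr q Z.π (Z.map σ) ⟶ Corr (q ≫ h.f₀) Y.π (Y.map (h.idx σ)) :=
  Corr.lift (Corr.left _ _ _) (Corr.mid _ _ _ ≫ h.f₁) (Corr.right _ _ _)
    (by rw [← Category.assoc, Corr.left_comp, Category.assoc, Category.assoc, h.comm_π])
    (by rw [← Category.assoc, Corr.right_comp, Category.assoc, Category.assoc, h.comm_map])

/-- The choices that make up a direct Galois closure of `h : (Z, σ) ⟶ (Y, σ)`: a Galois closure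
`T₀` of `Z₀` over `Y₀`, a connected component `O₁` of `T₀ ×_{Z₀} Z₁ ×_{Z₀} T₀` and the connected
component `T₁` of `T₀ ×_{Y₀} Y₁ ×_{Y₀} T₀` into which it is mapped. The fibre products are formed
with `π` on the left and `σ` on the right: a fibre product over `Z₀` along `σ` is the same as one
over the twist of `Z₀` by `ς`, with `T₀` replaced by its twist. -/
structure DirectGaloisClosure {Z Y : AlmostDirect ς} (h : Z ⟶ Y) (σ : Z.Idx) where
  T₀ : Scheme.{u}
  q : T₀ ⟶ Z.X₀
  isGaloisClosure : IsGaloisClosure q h.f₀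
  T₁ : Scheme.{u}
  j : T₁ ⟶ Corr (q ≫ h.f₀) Y.π (Y.map (h.idx σ))
  isComponent_j : IsComponent j
  O₁ : Scheme.{u}
  i : O₁ ⟶ Corr q Z.π (Z.map σ)
  isComponent_i : IsComponent i
  k : O₁ ⟶ T₁
  k_comp : k ≫ j = i ≫ corrMap h σ q

namespace DirectGaloisClosure

section

variable {Z Y : AlmostDirect ς} {h : Z ⟶ Y} {σ : Z.Idx} (D : DirectGaloisClosure h σ)

theorem comm_left : (D.j ≫ Corr.left _ _ _) ≫ D.q ≫ h.f₀ = (D.j ≫ Corr.mid _ _ _) ≫ Y.π := by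
  rw [Category.assoc, Corr.left_comp, Category.assoc]

theorem comm_right (g : Gal (D.q ≫ h.f₀)) :
    (D.j ≫ Corr.right _ _ _ ≫ g.toHom) ≫ D.q ≫ h.f₀ =
      (D.j ≫ Corr.mid _ _ _) ≫ Y.map (h.idx σ) := by
  rw [Category.assoc, Category.assoc, g.toHom_comp, Corr.right_comp, Category.assoc]

/-- `(Z̃, Σ̃)`, where `Σ̃` is the orbit under `Gal(T₀/Y₀)` of the projection of `T₁` to the right
factor `T₀`. -/
def tilde : AlmostDirect ς where
  X₀ := D.T₀
  X₁ := D.T₁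
  s₀ := (D.q ≫ h.f₀) ≫ Y.s₀
  s₁ := (D.j ≫ Corr.mid _ _ _) ≫ Y.s₁
  isVariety₀ := by
    have := D.isGaloisClosure.isGaloisCover.isFinite
    have := D.isGaloisClosure.isGaloisCover.etale
    exact Y.isVariety₀.of_finite_etale _
  isVariety₁ := by
    have := D.isGaloisClosure.isGaloisCover.isFinite
    have := D.isGaloisClosure.isGaloisCover.etale
    have := D.isComponent_j.isOpenImmersion
    have := D.isComponent_j.isClosedImmersion
    exact Y.isVariety₁.of_finite_etale _
  π := D.j ≫ Corr.left _ _ _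
  π_comp := by
    rw [← Category.assoc, D.comm_left, Category.assoc, Y.π_comp]
  Idx := Gal (D.q ≫ h.f₀)
  map g := D.j ≫ Corr.right _ _ _ ≫ g.toHom
  map_comp g := by
    rw [← Category.assoc, D.comm_right, Category.assoc, Y.map_comp, ← Category.assoc]

/-- `(Z̃, Σ̃) ⟶ (Y, σ)`. -/
def tildeToBase : D.tilde ⟶ Y where
  idx _ := h.idx σ
  f₀ := D.q ≫ h.f₀
  f₁ := D.j ≫ Corr.mid _ _ _
  f₀_comp := rfl
  f₁_comp := rfl
  comm_π := D.comm_left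
  comm_map := D.comm_right

end

section

variable {Z X Y : AlmostDirect ς} {p : Z ⟶ X} {f : X ⟶ Y} {σ : Z.Idx}
  (D : DirectGaloisClosure (p ≫ f) σ)

/-- The inclusion of `Gal(T₀/X₀)` into `Gal(T₀/Y₀)`. -/
def inclusion (g : Gal (D.q ≫ p.f₀)) : Gal (D.q ≫ (p ≫ f).f₀) where
  hom := Over.homMk g.hom.left (by
    have hg := Over.w g.hom
    simp only [Over.mk_left, Over.mk_hom] at hg
    change _ ≫ D.q ≫ p.f₀ ≫ f.f₀ = D.q ≫ p.f₀ ≫ f.f₀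
    rw [← Category.assoc D.q, ← Category.assoc g.hom.left, hg])
  inv := Over.homMk g.inv.left (by
    have hg := Over.w g.inv
    simp only [Over.mk_left, Over.mk_hom] at hg
    change _ ≫ D.q ≫ p.f₀ ≫ f.f₀ = D.q ≫ p.f₀ ≫ f.f₀
    rw [← Category.assoc D.q, ← Category.assoc g.inv.left, hg])
  hom_inv_id := by
    ext1
    exact congrArg (fun e => e.left) g.hom_inv_id
  inv_hom_id := by
    ext1
    exact congrArg (fun e => e.left) g.inv_hom_id

theorem inclusion_toHom (g : Gal (D.q ≫ p.f₀)) : (D.inclusion g).toHom = g.toHom := rfl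

theorem finite_etale_q (hp : AlmostDirectGaloisCover p)
    (hf : AlmostDirect.DirectlyFiniteEtale f) : IsFinite D.q ∧ Etale D.q := by
  have := hp.galois₀.isFinite
  have := hp.galois₀.etale
  have := hf.isFinite₀
  have := hf.etale₀
  have h1 : IsFinite (D.q ≫ p.f₀ ≫ f.f₀) := D.isGaloisClosure.isGaloisCover.isFinite
  have h2 : Etale (D.q ≫ p.f₀ ≫ f.f₀) := D.isGaloisClosure.isGaloisCover.etale
  exact ⟨IsFinite.of_comp D.q (p.f₀ ≫ f.f₀), Etale.of_comp D.q (p.f₀ ≫ f.f₀)⟩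

/-- Every automorphism of `T₀` over `X₀` induces one of `Z₀`. -/
theorem exists_restrict (hp : AlmostDirectGaloisCover p) (g : Gal (D.q ≫ p.f₀)) :
    ∃ g' : Gal p.f₀, g.toHom ≫ D.q = D.q ≫ g'.toHom := by
  have := hp.galois₀.isFinite
  have := hp.galois₀.etale
  have hc : ConnectedSpace D.T₀ := D.isGaloisClosure.isGaloisCover.connected
  obtain ⟨x⟩ := (inferInstance : Nonempty D.T₀)
  let K := AlgebraicClosure (D.T₀.residueField x)
  let t : Spec (.of K) ⟶ D.T₀ :=
    Spec.map (CommRingCat.ofHom (algebraMap (D.T₀.residueField x) K)) ≫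
      D.T₀.fromSpecResidueField x
  have hg : g.toHom ≫ D.q ≫ p.f₀ = D.q ≫ p.f₀ := g.toHom_comp
  obtain ⟨g', hg'⟩ := hp.galois₀.transitive K (t ≫ D.q) (t ≫ g.toHom ≫ D.q) (by
    simp only [Category.assoc, hg])
  refine ⟨g', hom_ext_of_point p.f₀ _ _ ?_ t ?_⟩
  · rw [Category.assoc, Category.assoc, hg, g'.toHom_comp]
  · rw [← hg', Category.assoc]

variable (hp : AlmostDirectGaloisCover p) (hf : AlmostDirect.DirectlyFiniteEtale f)

/-- The homomorphism `Gal(T₀/X₀) → Gal(Z₀/X₀)` (as a map). -/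
def restrict (g : Gal (D.q ≫ p.f₀)) : Gal p.f₀ := (D.exists_restrict hp g).choose

theorem restrict_comp (g : Gal (D.q ≫ p.f₀)) :
    g.toHom ≫ D.q = D.q ≫ (D.restrict hp g).toHom := (D.exists_restrict hp g).choose_spec

theorem comm_left_source :
    (D.i ≫ Corr.left _ _ _) ≫ D.q = (D.i ≫ Corr.mid _ _ _) ≫ Z.π := by
  rw [Category.assoc, Corr.left_comp, Category.assoc]

theorem comm_right_source (g : Gal (D.q ≫ p.f₀)) :
    (D.i ≫ Corr.right _ _ _ ≫ g.toHom) ≫ D.q =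
      (D.i ≫ Corr.mid _ _ _) ≫ Z.map (hp.act (D.restrict hp g) σ) := by
  have h1 := hp.map_act (D.restrict hp g) σ
  have h2 := D.restrict_comp hp g
  have h3 := Corr.right_comp D.q Z.π (Z.map σ)
  rw [Category.assoc, Category.assoc, h2, ← Category.assoc (Corr.right _ _ _), h3, h1]
  simp only [Category.assoc]

/-- `(Z̊, Σ̊)`, where `Σ̊` is the orbit under `Gal(T₀/X₀)` of the projection of `O₁` to the right
factor `T₀`. -/
def source : AlmostDirect ς where
  X₀ := D.T₀
  X₁ := D.O₁
  s₀ := D.q ≫ Z.s₀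
  s₁ := (D.i ≫ Corr.mid _ _ _) ≫ Z.s₁
  isVariety₀ := by
    obtain ⟨_, _⟩ := D.finite_etale_q hp hf
    exact Z.isVariety₀.of_finite_etale _
  isVariety₁ := by
    obtain ⟨_, _⟩ := D.finite_etale_q hp hf
    have := D.isComponent_i.isOpenImmersion
    have := D.isComponent_i.isClosedImmersion
    exact Z.isVariety₁.of_finite_etale _
  π := D.i ≫ Corr.left _ _ _
  π_comp := by
    rw [← Category.assoc, D.comm_left_source, Category.assoc, Z.π_comp]
  Idx := Gal (D.q ≫ p.f₀)
  map g := D.i ≫ Corr.right _ _ _ ≫ g.toHom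
  map_comp g := by
    rw [← Category.assoc, D.comm_right_source hp, Category.assoc, Z.map_comp, ← Category.assoc]

/-- `(Z̊, Σ̊) ⟶ (Z, Σ)`; on indices it is the surjection `Σ̊ → Σ`. -/
def sourceToCover : D.source hp hf ⟶ Z where
  idx g := hp.act (D.restrict hp g) σ
  f₀ := D.q
  f₁ := D.i ≫ Corr.mid _ _ _
  f₀_comp := rfl
  f₁_comp := rfl
  comm_π := D.comm_left_source
  comm_map := D.comm_right_source hp

theorem k_comp_left : D.k ≫ D.j ≫ Corr.left _ _ _ = D.i ≫ Corr.left _ _ _ := by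
  rw [← Category.assoc, D.k_comp, Category.assoc, corrMap, Corr.lift_left]

theorem k_comp_mid :
    D.k ≫ D.j ≫ Corr.mid _ _ _ = (D.i ≫ Corr.mid _ _ _) ≫ (p ≫ f).f₁ := by
  rw [← Category.assoc, D.k_comp, Category.assoc, corrMap, Corr.lift_mid, Category.assoc]

theorem k_comp_right : D.k ≫ D.j ≫ Corr.right _ _ _ = D.i ≫ Corr.right _ _ _ := by
  rw [← Category.assoc, D.k_comp, Category.assoc, corrMap, Corr.lift_right]

/-- `(Z̊, Σ̊) ⟶ (Z̃, Σ̃)`; on indices it is the inclusion `ι : Σ̊ → Σ̃`. -/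
def iota : D.source hp hf ⟶ D.tilde where
  idx := D.inclusion
  f₀ := 𝟙 D.T₀
  f₁ := D.k
  f₀_comp := by
    change 𝟙 D.T₀ ≫ (D.q ≫ p.f₀ ≫ f.f₀) ≫ Y.s₀ = D.q ≫ Z.s₀
    rw [Category.id_comp, Category.assoc, Category.assoc, f.f₀_comp, p.f₀_comp]
  f₁_comp := by
    change D.k ≫ (D.j ≫ Corr.mid _ _ _) ≫ Y.s₁ = (D.i ≫ Corr.mid _ _ _) ≫ Z.s₁
    rw [← Category.assoc, D.k_comp_mid, Category.assoc, (p ≫ f).f₁_comp]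
  comm_π := by
    change (D.i ≫ Corr.left _ _ _) ≫ 𝟙 D.T₀ = D.k ≫ D.j ≫ Corr.left _ _ _
    rw [Category.comp_id, D.k_comp_left]
  comm_map g := by
    change (D.i ≫ Corr.right _ _ _ ≫ g.toHom) ≫ 𝟙 D.T₀ = D.k ≫ D.j ≫ Corr.right _ _ _ ≫ g.toHom
    have h := D.k_comp_right
    rw [Category.comp_id, ← Category.assoc, ← h, Category.assoc, Category.assoc]

end

end DirectGaloisClosure

end

end DirectPresentation

/-!
Write `S(Z, B)` for the set of points of `(Z, Σ)` with a substitution in `B ⊆ Σ`. Substitutions of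
points are conjugated by the action of `G₁`, and a point of `Z` above a point of `(X, σ)` has just
one substitution, so that `⟨Z/X, C⟩` is the image of `S(Z, C)` for a conjugacy domain `C`, and
`⟨Z/X, B'⟩` is the image of `S(Z, B)` if `B'` is the least conjugacy domain containing `B`.

Both morphisms out of `Z̊` transport these sets. On `Z̊₁ ⟶ Z₁`, the image of `S(Z̊, C̊)` is
`S(Z, C)`: points lift along a finite étale surjection, and since `T₀ ⟶ X₀` is a Galois cover, the
lift can be given a substitution. On `Z̊₁ ⟶ Z̃₁`, the image of `S(Z̊, B)` is `S(Z̃, ι B)`, because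
`Z̊₀ = Z̃₀`. Going down from `Z̊₁` to `Y₁` in both ways yields the formula.
-/

namespace DirectPresentation

noncomputable section

/-! ### Field-valued points and étale morphisms -/

theorem exists_geometricPoint (X : Scheme.{u}) [hX : Nonempty X] :
    ∃ (K : Type u) (_ : Field K) (_ : IsAlgClosed K), Nonempty (Spec (.of K) ⟶ X) := by
  obtain ⟨x⟩ := hX
  exact ⟨AlgebraicClosure (X.residueField x), inferInstance, inferInstance,
    ⟨Spec.map (CommRingCat.ofHom (algebraMap (X.residueField x) _)) ≫ X.fromSpecResidueField x⟩⟩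

theorem exists_comp_eq_of_surjective {X Y : Scheme.{u}} (f : X ⟶ Y) [LocallyOfFiniteType f]
    [Surjective f] {K : Type u} [Field K] [IsAlgClosed K] (y : Spec (.of K) ⟶ Y) :
    ∃ x, x ≫ f = y := by
  let fibre : pullback f y ⟶ Spec (.of K) := pullback.snd f y
  obtain ⟨w, -⟩ := fibre.surjective (default : PrimeSpectrum K)
  have : JacobsonSpace ↑(pullback f y) := LocallyOfFiniteType.jacobsonSpace fibre
  obtain ⟨c, -, (hc : IsClosed {c})⟩ := nonempty_inter_closedPoints
    (Z := (Set.univ : Set ↑(pullback f y))) ⟨w, trivial⟩ isOpen_univ.isLocallyClosed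
  refine ⟨pointOfClosedPoint fibre c hc ≫ pullback.fst f y, ?_⟩
  rw [Category.assoc, pullback.condition, pointOfClosedPoint_comp_assoc]

theorem surjective_of_universallyClosed_of_universallyOpen {X Y : Scheme.{u}} (f : X ⟶ Y)
    [UniversallyClosed f] [UniversallyOpen f] [Nonempty X] [PreconnectedSpace Y] : Surjective f :=
  ⟨Set.range_eq_univ.mp (IsClopen.eq_univ
    ⟨f.isClosedMap.isClosed_range, f.isOpenMap.isOpen_range⟩ (Set.range_nonempty f))⟩

theorem hom_ext_of_comp_eq {W T Z X : Scheme.{u}} (p : Z ⟶ X) [Etale p] [IsSeparated p]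
    [PreconnectedSpace T] [Nonempty W] {a b : T ⟶ Z} (h : a ≫ p = b ≫ p) (t : W ⟶ T)
    (ht : t ≫ a = t ≫ b) : a = b := by
  obtain ⟨K, _, _, ⟨w⟩⟩ := exists_geometricPoint W
  exact hom_ext_of_point p a b h (w ≫ t) (by rw [Category.assoc, ht, Category.assoc])

/-! ### Automorphisms of covers -/

namespace Gal

variable {X Y : Scheme.{u}} {f : X ⟶ Y}

theorem toHom_mul (g h : Gal f) : (g * h).toHom = h.toHom ≫ g.toHom := rfl

theorem toHom_one : (1 : Gal f).toHom = 𝟙 X := rfl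

theorem toHom_comp_inv (g : Gal f) : g.toHom ≫ (g⁻¹).toHom = 𝟙 X := by
  rw [← toHom_mul, inv_mul_cancel, toHom_one]

theorem toHom_inv_comp (g : Gal f) : (g⁻¹).toHom ≫ g.toHom = 𝟙 X := by
  rw [← toHom_mul, mul_inv_cancel, toHom_one]

theorem ext_toHom {g h : Gal f} (e : g.toHom = h.toHom) : g = h :=
  Aut.ext (Over.OverMorphism.ext e)

end Gal

namespace IsGaloisCover

variable {X Y : Scheme.{u}} {f : X ⟶ Y}

theorem gal_ext (hf : IsGaloisCover f) {W : Scheme.{u}} [Nonempty W] (a : W ⟶ X) {g h : Gal f}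
    (e : a ≫ g.toHom = a ≫ h.toHom) : g = h := by
  have := hf.isFinite
  have := hf.etale
  have := hf.connected
  exact Gal.ext_toHom (hom_ext_of_comp_eq f (g.toHom_comp.trans h.toHom_comp.symm) a e)

theorem exists_comp_toHom_eq (hf : IsGaloisCover f) {W : Scheme.{u}} [ConnectedSpace W]
    {a b : W ⟶ X} (h : a ≫ f = b ≫ f) : ∃ g : Gal f, a ≫ g.toHom = b := by
  have := hf.isFinite
  have := hf.etale
  obtain ⟨K, _, _, ⟨t⟩⟩ := exists_geometricPoint W
  obtain ⟨g, hg⟩ := hf.transitive K (t ≫ a) (t ≫ b) (by simp only [Category.assoc, h])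
  refine ⟨g, hom_ext_of_comp_eq f ?_ t ?_⟩
  · rw [Category.assoc, g.toHom_comp, h]
  · rw [← hg, Category.assoc]

theorem of_comp {T : Scheme.{u}} {q : T ⟶ X} [Etale f] [IsSeparated f] [PreconnectedSpace X]
    (h : IsGaloisCover (q ≫ f)) : IsGaloisCover q := by
  have := h.isFinite
  have := h.etale
  have := h.connected
  have : IsFinite q := .of_comp q f
  have : Etale q := .of_comp q f
  refine ⟨inferInstance, inferInstance,
    surjective_of_universallyClosed_of_universallyOpen q, inferInstance, ?_⟩
  intro K _ _ x x' hx
  obtain ⟨g, hg⟩ := h.transitive K x x' (by rw [← Category.assoc, hx, Category.assoc])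
  have hgq : g.toHom ≫ q = q :=
    hom_ext_of_comp_eq f (by rw [Category.assoc, g.toHom_comp]) x (by rw [← Category.assoc, hg, hx])
  exact ⟨Over.isoMk ((Over.forget Y).mapIso g) hgq, hg⟩

section Induced

variable {X' Y' : Scheme.{u}} {f' : X' ⟶ Y'} [ConnectedSpace X]

theorem exists_toHom_comp_eq (hf' : IsGaloisCover f') {a : X ⟶ X'} {b : Y ⟶ Y'}
    (h : a ≫ f' = f ≫ b) (g : Gal f) : ∃ g' : Gal f', a ≫ g'.toHom = g.toHom ≫ a :=
  hf'.exists_comp_toHom_eq (by rw [Category.assoc, h, ← Category.assoc, g.toHom_comp])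

/-- The homomorphism of automorphism groups induced by a morphism of covers. -/
def inducedHom (hf' : IsGaloisCover f') {a : X ⟶ X'} {b : Y ⟶ Y'} (h : a ≫ f' = f ≫ b) :
    Gal f →* Gal f' :=
  MonoidHom.mk' (fun g => (hf'.exists_toHom_comp_eq h g).choose) fun g k => by
    have hchoose := fun g => (hf'.exists_toHom_comp_eq h g).choose_spec
    refine hf'.gal_ext a ?_
    rw [hchoose, Gal.toHom_mul, Gal.toHom_mul, ← Category.assoc a, hchoose, Category.assoc,
      Category.assoc, hchoose]

theorem toHom_comp_eq_comp_inducedHom (hf' : IsGaloisCover f') {a : X ⟶ X'} {b : Y ⟶ Y'}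
    (h : a ≫ f' = f ≫ b) (g : Gal f) : g.toHom ≫ a = a ≫ (hf'.inducedHom h g).toHom :=
  (hf'.exists_toHom_comp_eq h g).choose_spec.symm

end Induced

end IsGaloisCover

/-! ### Connected components of covers -/

namespace IsComponent

variable {T W B : Scheme.{u}} {j : T ⟶ W}

theorem connectedSpace (hj : IsComponent j) : ConnectedSpace T := by
  have := hj.isOpenImmersion
  obtain ⟨w, hw⟩ := hj.range_eq
  have hrange : _root_.IsConnected (Set.range j) := hw ▸ isConnected_connectedComponent
  rw [connectedSpace_iff_univ, _root_.IsConnected,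
    ← j.isOpenEmbedding.isInducing.isPreconnected_image, Set.image_univ]
  exact ⟨(Set.range_nonempty_iff_nonempty.mp hrange.nonempty).elim fun t => ⟨t, trivial⟩,
    hrange.isPreconnected⟩

theorem exists_lift (hj : IsComponent j) {S V : Scheme.{u}} [Nonempty S] [PreconnectedSpace V]
    (a : V ⟶ W) {v : S ⟶ V} {t : S ⟶ T} (h : v ≫ a = t ≫ j) : ∃ b : V ⟶ T, b ≫ j = a := by
  have := hj.isOpenImmersion
  refine ⟨IsOpenImmersion.lift j a ?_, IsOpenImmersion.lift_fac _ _ _⟩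
  obtain ⟨w, hw⟩ := hj.range_eq
  obtain ⟨s⟩ := ‹Nonempty S›
  have hmem : a (v s) ∈ connectedComponent w := by
    rw [← hw, ← Scheme.Hom.comp_apply, h]
    exact ⟨t s, rfl⟩
  rw [hw, connectedComponent_eq hmem]
  exact (isPreconnected_range a.continuous).subset_connectedComponent ⟨_, rfl⟩

theorem exists_gal_restrict (hj : IsComponent j) {f : W ⟶ B} (g : Gal f) {S : Scheme.{u}}
    [Nonempty S] {x x' : S ⟶ T} (h : x ≫ j ≫ g.toHom = x' ≫ j) :
    ∃ g' : Gal (j ≫ f), g'.toHom ≫ j = j ≫ g.toHom := by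
  have := hj.isOpenImmersion
  have := hj.connectedSpace
  obtain ⟨c, hc⟩ := hj.exists_lift (j ≫ g.toHom) h
  obtain ⟨d, hd⟩ := hj.exists_lift (j ≫ (g⁻¹).toHom) (v := x') (t := x) (by
    rw [← Category.assoc, ← h, Category.assoc, Category.assoc, g.toHom_comp_inv, Category.comp_id])
  have hcd : c ≫ d = 𝟙 T := by
    rw [← cancel_mono j, Category.assoc, hd, ← Category.assoc, hc, Category.assoc,
      g.toHom_comp_inv, Category.comp_id, Category.id_comp]
  have hdc : d ≫ c = 𝟙 T := by
    rw [← cancel_mono j, Category.assoc, hc, ← Category.assoc, hd, Category.assoc,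
      g.toHom_inv_comp, Category.comp_id, Category.id_comp]
  exact ⟨Over.isoMk ⟨c, d, hcd, hdc⟩ (by
    simp only [Over.mk_hom, ← Category.assoc c, hc, Category.assoc, g.toHom_comp]), hc⟩

theorem isGaloisCover_comp (hj : IsComponent j) {f : W ⟶ B} [IsFinite f] [Etale f]
    [PreconnectedSpace B]
    (hf : ∀ (K : Type u) [Field K] [IsAlgClosed K] (x x' : Spec (.of K) ⟶ W),
      x ≫ f = x' ≫ f → ∃ g : Gal f, x ≫ g.toHom = x') :
    IsGaloisCover (j ≫ f) := by
  have := hj.isOpenImmersion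
  have := hj.isClosedImmersion
  have := hj.connectedSpace
  refine ⟨inferInstance, inferInstance,
    surjective_of_universallyClosed_of_universallyOpen _, inferInstance, ?_⟩
  intro K _ _ x x' hx
  obtain ⟨g, hg⟩ := hf K (x ≫ j) (x' ≫ j) (by simpa only [Category.assoc] using hx)
  rw [Category.assoc] at hg
  have : Nonempty (Spec (.of K)) := inferInstanceAs (Nonempty (PrimeSpectrum K))
  obtain ⟨g', hg'⟩ := hj.exists_gal_restrict g hg
  exact ⟨g', by rw [← cancel_mono j, Category.assoc, hg', hg]⟩

end IsComponent

namespace Corr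

variable {T A B : Scheme.{u}} {q : T ⟶ A} {a b : B ⟶ A}

theorem hom_ext {V : Scheme.{u}} {c d : V ⟶ Corr q a b}
    (hl : c ≫ left q a b = d ≫ left q a b) (hm : c ≫ mid q a b = d ≫ mid q a b)
    (hr : c ≫ right q a b = d ≫ right q a b) : c = d := by
  have hmid : mid q a b = pullback.snd _ _ ≫ pullback.snd q b := pullback.condition
  refine pullback.hom_ext (pullback.hom_ext ?_ ?_) (pullback.hom_ext ?_ ?_)
  · simpa only [left, Category.assoc] using hl
  · simpa only [mid, Category.assoc] using hm
  · simpa only [right, Category.assoc] using hr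
  · simpa only [hmid, Category.assoc] using hm

/-- The action of a pair of automorphisms of `T` on the two outer factors of `T ×_A B ×_A T`. -/
def actHom (g k : Gal q) : Corr q a b ⟶ Corr q a b :=
  lift (left q a b ≫ g.toHom) (mid q a b) (right q a b ≫ k.toHom)
    (by rw [Category.assoc, g.toHom_comp, left_comp])
    (by rw [Category.assoc, k.toHom_comp, right_comp])

theorem actHom_left (g k : Gal q) : actHom g k ≫ left q a b = left q a b ≫ g.toHom :=
  lift_left _ _ _ _ _

theorem actHom_mid (g k : Gal q) : actHom g k ≫ mid q a b = mid q a b :=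
  lift_mid _ _ _ _ _

theorem actHom_right (g k : Gal q) : actHom g k ≫ right q a b = right q a b ≫ k.toHom :=
  lift_right _ _ _ _ _

theorem actHom_comp_actHom_inv (g k : Gal q) :
    actHom g k ≫ actHom g⁻¹ k⁻¹ = 𝟙 (Corr q a b) := by
  refine hom_ext ?_ ?_ ?_
  · rw [Category.assoc, actHom_left, ← Category.assoc, actHom_left, Category.assoc,
      g.toHom_comp_inv, Category.comp_id, Category.id_comp]
  · rw [Category.assoc, actHom_mid, actHom_mid, Category.id_comp]
  · rw [Category.assoc, actHom_right, ← Category.assoc, actHom_right, Category.assoc,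
      k.toHom_comp_inv, Category.comp_id, Category.id_comp]

theorem actHom_inv_comp_actHom (g k : Gal q) :
    actHom g⁻¹ k⁻¹ ≫ actHom g k = 𝟙 (Corr q a b) := by
  simpa only [inv_inv] using actHom_comp_actHom_inv g⁻¹ k⁻¹

/-- `actHom g k` as an automorphism over the middle factor `B`. -/
def gal (g k : Gal q) : Gal (mid q a b) :=
  Over.isoMk ⟨actHom g k, actHom g⁻¹ k⁻¹, actHom_comp_actHom_inv g k, actHom_inv_comp_actHom g k⟩
    (actHom_mid g k)

theorem exists_comp_toHom_eq (hq : IsGaloisCover q) {V : Scheme.{u}} [ConnectedSpace V]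
    {x x' : V ⟶ Corr q a b} (h : x ≫ mid q a b = x' ≫ mid q a b) :
    ∃ g : Gal (mid q a b), x ≫ g.toHom = x' := by
  have hl : (x ≫ left q a b) ≫ q = (x' ≫ left q a b) ≫ q := by
    rw [Category.assoc, Category.assoc, left_comp, ← Category.assoc, h, Category.assoc]
  have hr : (x ≫ right q a b) ≫ q = (x' ≫ right q a b) ≫ q := by
    rw [Category.assoc, Category.assoc, right_comp, ← Category.assoc, h, Category.assoc]
  obtain ⟨g, hg⟩ := hq.exists_comp_toHom_eq hl
  obtain ⟨k, hk⟩ := hq.exists_comp_toHom_eq hr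
  refine ⟨gal g k, show x ≫ actHom g k = x' from hom_ext ?_ ?_ ?_⟩
  · rw [Category.assoc, actHom_left, ← Category.assoc, hg]
  · rw [Category.assoc, actHom_mid, h]
  · rw [Category.assoc, actHom_right, ← Category.assoc, hk]

theorem isGaloisCover_mid (hq : IsGaloisCover q) [PreconnectedSpace B] {T₁ : Scheme.{u}}
    {j : T₁ ⟶ Corr q a b} (hj : IsComponent j) : IsGaloisCover (j ≫ mid q a b) := by
  have := hq.isFinite
  have := hq.etale
  exact hj.isGaloisCover_comp fun _ _ _ _ _ h => exists_comp_toHom_eq hq h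

end Corr

variable {R : Type u} [CommRing R] {ς : R →+* R}

/-! ### Points with prescribed substitutions -/

instance (P : Param ς) : Nonempty P.spec :=
  inferInstanceAs (Nonempty (PrimeSpectrum P.F))

section Points

variable {X Y : AlmostDirect ς} {P : Param ς}

theorem IsSubst.map {x : P.spec ⟶ X.X₁} {σ : X.Idx} (hx : IsSubst X P x σ) (f : X ⟶ Y) :
    IsSubst Y P (x ≫ f.f₁) (f.idx σ) := by
  unfold IsSubst at hx ⊢
  rw [Category.assoc, ← f.comm_map, ← Category.assoc, hx]
  simp only [Category.assoc, f.comm_π]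

variable (X P) in
/-- The `(F, φ)`-points of `(X, Σ)` which have a substitution in `B ⊆ Σ`; for `B = Σ` these are all
of `points X P`. -/
def pointsWithSubst (B : Set X.Idx) : Set (P.spec ⟶ X.X₁) :=
  {x | x ≫ X.s₁ = P.toBase ∧ ∃ σ ∈ B, IsSubst X P x σ}

theorem pointsWithSubst_univ : pointsWithSubst X P Set.univ = points X P := by
  simp only [pointsWithSubst, points, Set.mem_univ, true_and]

theorem pointsWithSubst_mono {B C : Set X.Idx} (h : B ⊆ C) :
    pointsWithSubst X P B ⊆ pointsWithSubst X P C :=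
  fun _ ⟨hs, σ, hσ, hx⟩ => ⟨hs, σ, h hσ, hx⟩

theorem image_pointsWithSubst (f : X ⟶ Y) [LocallyOfFiniteType f.f₁] [Surjective f.f₁]
    {B : Set X.Idx} {C : Set Y.Idx} (hBC : Set.MapsTo f.idx B C)
    (hlift : ∀ τ ∈ C, ∀ (x : P.spec ⟶ X.X₁) (x₀ : P.spec ⟶ X.X₀),
      (x ≫ f.f₁) ≫ Y.map τ = x₀ ≫ f.f₀ → ∃ σ ∈ B, x ≫ X.map σ = x₀) :
    (· ≫ f.f₁) '' pointsWithSubst X P B = pointsWithSubst Y P C := by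
  refine Set.Subset.antisymm ?_ ?_
  · rintro _ ⟨x, ⟨hs, σ, hσ, hx⟩, rfl⟩
    exact ⟨by rw [Category.assoc, f.f₁_comp, hs], f.idx σ, hBC hσ, hx.map f⟩
  · rintro y ⟨hs, τ, hτ, hy⟩
    obtain ⟨x, rfl⟩ := exists_comp_eq_of_surjective f.f₁ y
    obtain ⟨σ, hσ, hx⟩ := hlift τ hτ x (P.phi ≫ x ≫ X.π) (by
      rw [hy]
      simp only [Category.assoc, f.comm_π])
    exact ⟨x, ⟨by rw [← hs, Category.assoc, f.f₁_comp], σ, hσ, hx⟩, rfl⟩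

theorem image_pointsWithSubst_of_mono (f : X ⟶ Y) [LocallyOfFiniteType f.f₁] [Surjective f.f₁]
    [Mono f.f₀] (B : Set X.Idx) :
    (· ≫ f.f₁) '' pointsWithSubst X P B = pointsWithSubst Y P (f.idx '' B) := by
  refine image_pointsWithSubst f (Set.mapsTo_image _ _) ?_
  rintro _ ⟨σ, hσ, rfl⟩ x x₀ h
  refine ⟨σ, hσ, ?_⟩
  rw [← cancel_mono f.f₀, ← h, Category.assoc, f.comm_map, Category.assoc]

end Points

/-! ### Almost direct Galois covers -/

namespace AlmostDirectGaloisCover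

variable {Z X : AlmostDirect ς} {p : Z ⟶ X}

/-- An almost direct Galois cover from its action on indices: the homomorphisms `g ↦ g ^ π` and
`g ↦ g ^ σ` are determined by the covers `Zᵢ ⟶ Xᵢ`. -/
def ofAct (galois₀ : IsGaloisCover p.f₀) (galois₁ : IsGaloisCover p.f₁)
    (act : Gal p.f₀ →* Equiv.Perm Z.Idx) (map_act : ∀ g σ, Z.map (act g σ) = Z.map σ ≫ g.toHom)
    (idx_surjective : Function.Surjective p.idx)
    (idx_eq_iff : ∀ σ τ, p.idx σ = p.idx τ ↔ ∃ g, act g σ = τ) : AlmostDirectGaloisCover p :=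
  have := galois₁.connected
  { galois₀, galois₁, act, map_act, idx_surjective, idx_eq_iff
    piHom := galois₀.inducedHom p.comm_π
    piHom_comm := galois₀.toHom_comp_eq_comp_inducedHom p.comm_π
    mapHom := fun σ => galois₀.inducedHom (p.comm_map σ)
    mapHom_comm := fun σ => galois₀.toHom_comp_eq_comp_inducedHom (p.comm_map σ) }

variable (hp : AlmostDirectGaloisCover p)

theorem mapHom_act (g : Gal p.f₀) (τ : Z.Idx) (k : Gal p.f₁) :
    hp.mapHom (hp.act g τ) k = g * hp.mapHom τ k * g⁻¹ := by
  have := hp.galois₁.connected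
  refine hp.galois₀.gal_ext (Z.map (hp.act g τ)) ?_
  rw [← hp.mapHom_comm, hp.map_act, Gal.toHom_mul, Gal.toHom_mul, ← Category.assoc,
    hp.mapHom_comm]
  simp only [Category.assoc]
  rw [← Category.assoc g.toHom, Gal.toHom_comp_inv, Category.id_comp]

theorem conj_one (τ : Z.Idx) : hp.conj 1 τ = τ := by
  simp only [conj, inv_one, map_one, mul_one, Equiv.Perm.one_apply]

theorem conj_mul (g k : Gal p.f₁) (τ : Z.Idx) : hp.conj (g * k) τ = hp.conj g (hp.conj k τ) := by
  unfold conj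
  rw [hp.mapHom_act, ← Equiv.Perm.mul_apply, ← map_mul]
  simp only [map_mul, map_inv, mul_inv_rev]
  group

theorem isConjDomain_leastConjDomain (B : Set Z.Idx) : hp.IsConjDomain (hp.leastConjDomain B) :=
  fun τ hτ g C hC hB => hC τ (hτ C hC hB) g

theorem subset_leastConjDomain (B : Set Z.Idx) : B ⊆ hp.leastConjDomain B :=
  fun _ hτ _ _ hB => hB hτ

theorem exists_conj_eq_of_mem_leastConjDomain {B : Set Z.Idx} {τ : Z.Idx}
    (hτ : τ ∈ hp.leastConjDomain B) : ∃ σ ∈ B, ∃ g, hp.conj g σ = τ := by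
  refine hτ {τ | ∃ σ ∈ B, ∃ g, hp.conj g σ = τ} ?_ fun σ hσ => ⟨σ, hσ, 1, hp.conj_one σ⟩
  rintro _ ⟨σ, hσ, g, rfl⟩ k
  exact ⟨σ, hσ, k * g, hp.conj_mul k g σ⟩

section Subst

variable {P : Param ς} {z : P.spec ⟶ Z.X₁} {τ τ' : Z.Idx}

include hp in
theorem eq_of_comp_map_eq (hττ' : p.idx τ = p.idx τ') (h : z ≫ Z.map τ = z ≫ Z.map τ') :
    τ = τ' := by
  obtain ⟨g, rfl⟩ := (hp.idx_eq_iff τ τ').mp hττ'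
  have hg : g = 1 := hp.galois₀.gal_ext (z ≫ Z.map τ) (by
    rw [Gal.toHom_one, Category.comp_id, Category.assoc, ← hp.map_act]
    exact h.symm)
  rw [hg, map_one, Equiv.Perm.one_apply]

theorem isSubst_conj (hz : IsSubst Z P z τ) (g : Gal p.f₁) :
    IsSubst Z P (z ≫ g.toHom) (hp.conj g τ) := by
  unfold IsSubst at hz ⊢
  rw [conj, hp.map_act, Gal.toHom_mul, Category.assoc, ← Category.assoc g.toHom,
    hp.mapHom_comm, Category.assoc, ← Category.assoc (hp.mapHom τ g).toHom, map_inv,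
    Gal.toHom_comp_inv, Category.id_comp, Category.assoc, hp.piHom_comm, ← Category.assoc, hz]
  simp only [Category.assoc]

include hp in
theorem image_points : (· ≫ p.f₁) '' points Z P = points X P := by
  have := hp.galois₁.isFinite
  have := hp.galois₁.surjective
  simp only [← pointsWithSubst_univ]
  refine image_pointsWithSubst p (Set.mapsTo_univ _ _) fun t _ x x₀ h => ?_
  obtain ⟨σ, rfl⟩ := hp.idx_surjective t
  obtain ⟨g, hg⟩ := hp.galois₀.transitive P.F (x ≫ Z.map σ) x₀ (by
    rw [← h, Category.assoc, p.comm_map, Category.assoc])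
  exact ⟨hp.act g σ, trivial, by rw [hp.map_act, ← Category.assoc, hg]⟩

theorem localSubst_eq_range_conj [Subsingleton X.Idx] (hs : z ≫ Z.s₁ = P.toBase)
    (hz : IsSubst Z P z τ) :
    hp.localSubst P (z ≫ p.f₁) = Set.range fun g => hp.conj g τ := by
  refine Set.Subset.antisymm ?_ ?_
  · rintro _ ⟨z', -, hzz', τ', hz', g, rfl⟩
    obtain ⟨k, rfl⟩ := hp.galois₁.transitive P.F z z' hzz'.symm
    have hτ' : τ' = hp.conj k τ := hp.eq_of_comp_map_eq (Subsingleton.elim _ _)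
      (hz'.trans (hp.isSubst_conj hz k).symm)
    exact ⟨g * k, by simp only [hτ', hp.conj_mul]⟩
  · rintro _ ⟨g, rfl⟩
    exact ⟨z, ⟨hs, τ, hz⟩, rfl, τ, hz, g, rfl⟩

theorem formulaPoints_eq_image [Subsingleton X.Idx] {C : Set Z.Idx} (hC : hp.IsConjDomain C) :
    hp.formulaPoints C P = (· ≫ p.f₁) '' pointsWithSubst Z P C := by
  ext x
  constructor
  · rintro ⟨hx, hxC⟩
    rw [← hp.image_points] at hx
    obtain ⟨z, ⟨hs, τ, hz⟩, rfl⟩ := hx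
    rw [hp.localSubst_eq_range_conj hs hz] at hxC
    exact ⟨z, ⟨hs, τ, hxC ⟨1, hp.conj_one τ⟩, hz⟩, rfl⟩
  · rintro ⟨z, ⟨hs, τ, hτ, hz⟩, rfl⟩
    refine ⟨hp.image_points ▸ ⟨z, ⟨hs, τ, hz⟩, rfl⟩, ?_⟩
    rw [hp.localSubst_eq_range_conj hs hz]
    rintro _ ⟨g, rfl⟩
    exact hC τ hτ g

theorem formulaPoints_leastConjDomain [Subsingleton X.Idx] (B : Set Z.Idx) :
    hp.formulaPoints (hp.leastConjDomain B) P = (· ≫ p.f₁) '' pointsWithSubst Z P B := by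
  rw [hp.formulaPoints_eq_image (hp.isConjDomain_leastConjDomain B)]
  refine Set.Subset.antisymm ?_
    (Set.image_mono (pointsWithSubst_mono (hp.subset_leastConjDomain B)))
  rintro _ ⟨z, ⟨hs, τ, hτ, hz⟩, rfl⟩
  obtain ⟨σ, hσ, g, rfl⟩ := hp.exists_conj_eq_of_mem_leastConjDomain hτ
  have hzg : IsSubst Z P (z ≫ (g⁻¹).toHom) σ := by
    simpa only [← hp.conj_mul, inv_mul_cancel, hp.conj_one] using hp.isSubst_conj hz g⁻¹
  refine ⟨z ≫ (g⁻¹).toHom, ⟨?_, σ, hσ, hzg⟩, ?_⟩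
  · rw [← p.f₁_comp, Category.assoc, ← Category.assoc (Gal.toHom _), Gal.toHom_comp, p.f₁_comp, hs]
  · simp only [Category.assoc, Gal.toHom_comp]

end Subst

end AlmostDirectGaloisCover

/-! ### The direct Galois closure -/

namespace DirectGaloisClosure

/-- `(Z̃, Σ̃) ⟶ (Y, σ)` as an almost direct Galois cover; `Gal(T₀/Y₀)` acts on `Σ̃` simply
transitively, by left multiplication. -/
def tildeCover {Z Y : AlmostDirect ς} [Subsingleton Y.Idx] [PreconnectedSpace Y.X₁] {h : Z ⟶ Y}
    {σ : Z.Idx} (D : DirectGaloisClosure h σ) : AlmostDirectGaloisCover D.tildeToBase :=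
  .ofAct D.isGaloisClosure.isGaloisCover
    (Corr.isGaloisCover_mid D.isGaloisClosure.isGaloisCover D.isComponent_j)
    (MulAction.toPermHom (Gal (D.q ≫ h.f₀)) (Gal (D.q ≫ h.f₀)))
    (fun (g τ : Gal (D.q ≫ h.f₀)) =>
      show D.j ≫ Corr.right _ _ _ ≫ τ.toHom ≫ g.toHom =
        (D.j ≫ Corr.right _ _ _ ≫ τ.toHom) ≫ g.toHom by simp only [Category.assoc])
    (fun _ => ⟨(1 : Gal (D.q ≫ h.f₀)), Subsingleton.elim _ _⟩)
    (fun τ τ' => iff_of_true (Subsingleton.elim _ _)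
      (MulAction.exists_smul_eq (Gal (D.q ≫ h.f₀)) (α := Gal (D.q ≫ h.f₀)) τ τ'))

variable {Z X Y : AlmostDirect ς} {p : Z ⟶ X} {f : X ⟶ Y} {σ : Z.Idx}
  (D : DirectGaloisClosure (p ≫ f) σ)
  (hp : AlmostDirectGaloisCover p) (hf : AlmostDirect.DirectlyFiniteEtale f)

include hp hf in
theorem isGaloisCover_q_comp : IsGaloisCover (D.q ≫ p.f₀) := by
  have := hf.isFinite₀
  have := hf.etale₀
  have := hp.galois₀.connected
  have : ConnectedSpace X.X₀ :=
    hp.galois₀.surjective.surj.connectedSpace p.f₀.continuous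
  have hcover : IsGaloisCover (D.q ≫ p.f₀ ≫ f.f₀) := D.isGaloisClosure.isGaloisCover
  rw [← Category.assoc] at hcover
  exact hcover.of_comp

theorem exists_comp_source_map_eq {P : Param ς} {o : P.spec ⟶ (D.source hp hf).X₁}
    {x₀ : P.spec ⟶ (D.source hp hf).X₀} (g : (D.source hp hf).Idx)
    (h : (o ≫ (D.source hp hf).map g) ≫ (D.sourceToCover hp hf ≫ p).f₀ =
      x₀ ≫ (D.sourceToCover hp hf ≫ p).f₀) :
    ∃ g' : (D.source hp hf).Idx, o ≫ (D.source hp hf).map g' = x₀ := by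
  let o' : P.spec ⟶ D.O₁ := o
  let τ : Gal (D.q ≫ p.f₀) := g
  obtain ⟨k, hk⟩ := (D.isGaloisCover_q_comp hp hf).transitive P.F _ _ h
  have hmap : o' ≫ D.i ≫ Corr.right _ _ _ ≫ (k * τ).toHom =
      (o' ≫ D.i ≫ Corr.right _ _ _ ≫ τ.toHom) ≫ k.toHom := by
    simp only [Gal.toHom_mul, Category.assoc]
  exact ⟨k * τ, hmap.trans hk⟩

theorem isFinite_sourceToCover_f₁ : IsFinite (D.sourceToCover hp hf).f₁ := by
  obtain ⟨_, _⟩ := D.finite_etale_q hp hf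
  have := D.isComponent_i.isClosedImmersion
  exact inferInstanceAs (IsFinite (D.i ≫ Corr.mid D.q Z.π (Z.map σ)))

theorem etale_sourceToCover_f₁ : Etale (D.sourceToCover hp hf).f₁ := by
  obtain ⟨_, _⟩ := D.finite_etale_q hp hf
  have := D.isComponent_i.isOpenImmersion
  exact inferInstanceAs (Etale (D.i ≫ Corr.mid D.q Z.π (Z.map σ)))

theorem surjective_sourceToCover_f₁ : Surjective (D.sourceToCover hp hf).f₁ := by
  have := D.isFinite_sourceToCover_f₁ hp hf
  have := D.etale_sourceToCover_f₁ hp hf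
  have := hp.galois₁.connected
  have : ConnectedSpace (D.source hp hf).X₁ := D.isComponent_i.connectedSpace
  exact surjective_of_universallyClosed_of_universallyOpen _

theorem iota_comp_tildeToBase_f₁ :
    (D.iota hp hf).f₁ ≫ D.tildeToBase.f₁ = (D.sourceToCover hp hf).f₁ ≫ p.f₁ ≫ f.f₁ :=
  D.k_comp_mid

theorem isFinite_iota_f₁ : IsFinite (D.iota hp hf).f₁ := by
  have := D.isFinite_sourceToCover_f₁ hp hf
  have := hp.galois₁.isFinite
  have := hf.isFinite₁
  have : IsFinite ((D.iota hp hf).f₁ ≫ D.tildeToBase.f₁) := by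
    rw [iota_comp_tildeToBase_f₁]
    infer_instance
  have := D.isGaloisClosure.isGaloisCover.isFinite
  have := D.isComponent_j.isClosedImmersion
  have : IsFinite D.tildeToBase.f₁ := inferInstanceAs (IsFinite (D.j ≫ Corr.mid _ _ _))
  exact .of_comp _ D.tildeToBase.f₁

theorem etale_iota_f₁ : Etale (D.iota hp hf).f₁ := by
  have := D.etale_sourceToCover_f₁ hp hf
  have := hp.galois₁.etale
  have := hf.etale₁
  have : Etale ((D.iota hp hf).f₁ ≫ D.tildeToBase.f₁) := by
    rw [iota_comp_tildeToBase_f₁]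
    infer_instance
  have := D.isGaloisClosure.isGaloisCover.etale
  have := D.isComponent_j.isOpenImmersion
  have : Etale D.tildeToBase.f₁ := inferInstanceAs (Etale (D.j ≫ Corr.mid _ _ _))
  exact .of_comp _ D.tildeToBase.f₁

theorem surjective_iota_f₁ : Surjective (D.iota hp hf).f₁ := by
  have := D.isFinite_iota_f₁ hp hf
  have := D.etale_iota_f₁ hp hf
  have : ConnectedSpace (D.source hp hf).X₁ := D.isComponent_i.connectedSpace
  have : ConnectedSpace D.tilde.X₁ := D.isComponent_j.connectedSpace
  exact surjective_of_universallyClosed_of_universallyOpen _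

theorem image_sourceToCover_pointsWithSubst [Subsingleton X.Idx] (P : Param ς) (C : Set Z.Idx) :
    (· ≫ (D.sourceToCover hp hf).f₁) ''
        pointsWithSubst (D.source hp hf) P ((D.sourceToCover hp hf).idx ⁻¹' C) =
      pointsWithSubst Z P C := by
  have := D.isFinite_sourceToCover_f₁ hp hf
  have := D.surjective_sourceToCover_f₁ hp hf
  refine image_pointsWithSubst _ (Set.mapsTo_preimage _ _) fun τ hτ o x₀ h => ?_
  let one : (D.source hp hf).Idx := (1 : Gal (D.q ≫ p.f₀))
  have hidx : (D.sourceToCover hp hf ≫ p).idx one = p.idx τ := Subsingleton.elim _ _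
  obtain ⟨g, rfl⟩ := D.exists_comp_source_map_eq hp hf (o := o) (x₀ := x₀) one <|
    calc (o ≫ (D.source hp hf).map one) ≫ (D.sourceToCover hp hf ≫ p).f₀
        = (o ≫ (D.sourceToCover hp hf).f₁) ≫ p.f₁ ≫ X.map (p.idx τ) := by
          rw [Category.assoc, AlmostDirect.Hom.comm_map, hidx, AlmostDirect.comp_f₁]
          simp only [Category.assoc]
      _ = x₀ ≫ (D.sourceToCover hp hf).f₀ ≫ p.f₀ := by
          rw [← p.comm_map, ← Category.assoc, h, Category.assoc]
  have hgτ : (D.sourceToCover hp hf).idx g = τ :=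
    hp.eq_of_comp_map_eq (Subsingleton.elim _ _) (z := o ≫ (D.sourceToCover hp hf).f₁) (by
      rw [h, Category.assoc, Category.assoc, (D.sourceToCover hp hf).comm_map])
  exact ⟨g, Set.mem_preimage.mpr (hgτ ▸ hτ), rfl⟩

theorem image_iota_pointsWithSubst (P : Param ς) (B : Set (D.source hp hf).Idx) :
    (· ≫ (D.iota hp hf).f₁) '' pointsWithSubst (D.source hp hf) P B =
      pointsWithSubst D.tilde P ((D.iota hp hf).idx '' B) := by
  have := D.isFinite_iota_f₁ hp hf
  have := D.surjective_iota_f₁ hp hf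
  have : Mono (D.iota hp hf).f₀ := inferInstanceAs (Mono (𝟙 D.T₀))
  exact image_pointsWithSubst_of_mono _ B

theorem image_formulaPoints [Subsingleton X.Idx] [Subsingleton Y.Idx]
    (hq : AlmostDirectGaloisCover D.tildeToBase) {C : Set Z.Idx} (hC : hp.IsConjDomain C)
    (P : Param ς) :
    (· ≫ f.f₁) '' hp.formulaPoints C P = hq.formulaPoints (hq.leastConjDomain
      ((D.iota hp hf).idx '' ((D.sourceToCover hp hf).idx ⁻¹' C))) P := by
  rw [hp.formulaPoints_eq_image hC, hq.formulaPoints_leastConjDomain,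
    ← D.image_iota_pointsWithSubst, ← D.image_sourceToCover_pointsWithSubst hp hf]
  simp only [Set.image_image, Category.assoc, D.iota_comp_tildeToBase_f₁]

end DirectGaloisClosure

end

end DirectPresentation

theorem mainTheorem8_general {R : Type u} [CommRing R] {ς : R →+* R} {Z X Y : AlmostDirect ς}
    [Subsingleton X.Idx] [Subsingleton Y.Idx] [PreconnectedSpace Y.X₁]
    {f : X ⟶ Y} (hf : AlmostDirect.DirectlyFiniteEtale f)
    {p : Z ⟶ X} (hp : AlmostDirectGaloisCover p)
    {σ : Z.Idx} (D : DirectGaloisClosure (p ≫ f) σ) :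
    Nonempty (AlmostDirectGaloisCover D.tildeToBase) ∧
      ∀ (hq : AlmostDirectGaloisCover D.tildeToBase) (C : Set Z.Idx), hp.IsConjDomain C →
        Equivalent (existsImage f (hp.formula C))
          (hq.formula (hq.leastConjDomain
            ((D.iota hp hf).idx '' ((D.sourceToCover hp hf).idx ⁻¹' C)))) := by
  refine ⟨⟨D.tildeCover⟩, fun hq C hC P => ?_⟩
  unfold existsImage AlmostDirectGaloisCover.formula
  rw [← D.image_formulaPoints hp hf hq hC P]
  simp only [Set.image_image, Category.assoc, f.comm_π]

theorem mainTheorem8 {R : Type u} [CommRing R] [IsDomain R] (ς : R →+* R)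
    (hς : Function.Injective ς) {Z X Y : AlmostDirect ς} [Unique X.Idx] [Unique Y.Idx]
    [ConnectedSpace Y.X₀] [ConnectedSpace Y.X₁]
    (f : X ⟶ Y) (hf : AlmostDirect.DirectlyFiniteEtale f)
    (p : Z ⟶ X) (hp : AlmostDirectGaloisCover p)
    (σ : Z.Idx) (D : DirectGaloisClosure (p ≫ f) σ) :
    ∃ hq : AlmostDirectGaloisCover D.tildeToBase,
      ∀ C : Set Z.Idx, hp.IsConjDomain C →
        Equivalent (existsImage f (hp.formula C))
          (hq.formula (hq.leastConjDomain
            ((D.iota hp hf).idx '' ((D.sourceToCover hp hf).idx ⁻¹' C)))) := by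
  obtain ⟨⟨hq⟩, hformula⟩ := mainTheorem8_general hf hp D
  exact ⟨hq, hformula hq⟩
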